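/- All graphs are finite, simple and undirected. For a graph $G$, $\rho(G)$ denotes the largest eigenvalue of its adjacency matrix. A connected graph is $t$-connected if it has more than $t$ vertices and remains connected whenever fewer than $t$ vertices are removed; a graph $G$ is $k$-factor-critical if $G-S$ has a perfect matching for every $S\subseteq V(G)$ with $|S|=k$. For disjoint graphs, $G+H$ is the disjoint union, $mK_1$ is the edgeless graph on $m$ vertices, and $G\vee H$ is the join, obtained from $G+H$ by adding all edges between $V(G)$ and $V(H)$. **Theorem.** Let $t,k$ be integers with $t\ge k\ge 1$, and let $G$ be a $t$-connected graph of order $$n\ge\max\left\{\tfrac{15t-11k+29}{2},\; t^2+\tfrac52 t+2\right\},\qquad n\equiv k \pmod 2 .$$ If $$\rho(G)\ \ge\ \rho\bigl(K_t\vee(K_{n+k-2t-1}+(t-k+1)K_1)\bigr),$$ then $G$ is $k$-factor-critical unless $G\cong K_t\vee(K_{n+k-2t-1}+(t-k+1)K_1)$, and in this exceptional case $G$ is not $k$-factor-critical. -/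

import Mathlib

namespace SimpleGraph

/-- A graph is `t`-connected if it is connected, has more than `t` vertices, and remains connected
whenever fewer than `t` vertices are removed. -/
def IsTConnected {V : Type*} [Fintype V] (G : SimpleGraph V) (t : ℕ) : Prop :=
  G.Connected ∧ t < Fintype.card V ∧
    ∀ S : Finset V, S.card < t → (G.induce ((S : Set V)ᶜ)).Connected

/-- A graph is `k`-factor-critical if deleting any `k` vertices leaves a graph with a perfect
matching. -/
def IsKFactorCritical {V : Type*} (G : SimpleGraph V) (k : ℕ) : Prop :=
  ∀ S : Finset V, S.card = k →
    ∃ M : (G.induce ((S : Set V)ᶜ)).Subgraph, M.IsPerfectMatching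

open Classical in
/-- The spectral radius `ρ(G)`: the largest eigenvalue of the (real) adjacency matrix. The set of
eigenvalues is finite, and it is nonempty as soon as the graph has a vertex, so that the supremum
is a maximum. -/
noncomputable def adjSpectralRadius {V : Type*} [Fintype V] (G : SimpleGraph V) : ℝ :=
  sSup {μ : ℝ | Module.End.HasEigenvalue (G.adjMatrix ℝ).mulVecLin μ}

/-- The join `G ∨ H`: the disjoint union together with all edges between the two parts. -/
def joinGraph {V W : Type*} (G : SimpleGraph V) (H : SimpleGraph W) : SimpleGraph (V ⊕ W) :=
  (G ⊕g H) ⊔ completeBipartiteGraph V W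

/-- The graph `K_t ∨ (K_{n+k-2t-1} + (t-k+1) K_1)`, for `k ≤ t` and `2t + 1 ≤ n + k`. -/
def extremalGraph (n k t : ℕ) :
    SimpleGraph (Fin t ⊕ (Fin (n + k - 2 * t - 1) ⊕ Fin (t - k + 1))) :=
  joinGraph (⊤ : SimpleGraph (Fin t))
    ((⊤ : SimpleGraph (Fin (n + k - 2 * t - 1))) ⊕g (⊥ : SimpleGraph (Fin (t - k + 1))))

end SimpleGraph

/-!
Suppose `G` is `t`-connected but not `k`-factor-critical. Tutte's theorem, with a parity count,
gives a set `S` of `s ≥ k` vertices such that `G - S` has at least `s - k + 2` components, and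
`t`-connectedness forces `s ≥ t` (`exists_barrier`). Grouping the components into exactly
`s - k + 2` classes bounds the number `m` of edges (`sum_degree_add_card_le`): it is largest
when all classes but one are singletons, and among such configurations when `s` is
at one end of its range.

Put `N = n + k - t - 2`. The extremal graph properly contains a clique on `N + 1` vertices, and a
Rayleigh quotient shows that its spectral radius exceeds `N`
(`lt_adjSpectralRadius_extremalGraph`). On the other hand Hong's bound `ρ(G)² ≤ 2m - n + 1`
(`sq_adjSpectralRadius_le`) gives `ρ(G) ≤ N` when `s > t` (`barrier_bound_large`), and also when
`s = t` and two classes have at least two vertices each (`barrier_bound_small`). There remains the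
case `s = t` with at most one class that is not a singleton. Then `G` is a spanning subgraph of the
extremal graph (`exists_equiv_extremalGraph`), and since `G` is connected, `ρ(G)` is strictly
smaller unless the two graphs coincide (`Connected.adjSpectralRadius_lt`, by a
positive eigenvector of `G`).

Conversely, deleting `k` dominating vertices of the extremal graph leaves `t - k + 1` isolated
vertices that have to be matched into `t - k` vertices (`not_isKFactorCritical_of_iso`).
-/

namespace SimpleGraph

/-! ### Spectral radius: Rayleigh principle, monotonicity and Hong's bound -/

section Spectral

open Matrix

variable {V W : Type*} [Fintype V] [Fintype W]

open Classical in
theorem le_adjSpectralRadius (G : SimpleGraph V) {μ : ℝ}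
    (h : Module.End.HasEigenvalue (G.adjMatrix ℝ).mulVecLin μ) : μ ≤ G.adjSpectralRadius :=
  le_csSup (Module.End.finite_hasEigenvalue _).bddAbove h

open Classical in
/-- `ρ(G) I - A` is positive semidefinite: if `ν` is an eigenvalue of it, then `ρ(G) - ν` is an
eigenvalue of `A`. -/
theorem posSemidef_adjSpectralRadius_sub (G : SimpleGraph V) :
    (G.adjSpectralRadius • (1 : Matrix V V ℝ) - G.adjMatrix ℝ).PosSemidef := by
  have hA : (G.adjMatrix ℝ).IsHermitian := by
    rw [Matrix.IsHermitian, conjTranspose_eq_transpose_of_trivial]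
    exact G.transpose_adjMatrix
  have hB : (G.adjSpectralRadius • (1 : Matrix V V ℝ) - G.adjMatrix ℝ).IsHermitian :=
    (isHermitian_one.smul (IsSelfAdjoint.all _)).sub hA
  rw [hB.posSemidef_iff_eigenvalues_nonneg]
  intro i
  have h := hB.mulVec_eigenvectorBasis i
  have hne : (⇑(hB.eigenvectorBasis i) : V → ℝ) ≠ 0 := by
    intro h0
    exact hB.eigenvectorBasis.orthonormal.ne_zero i (by ext v; exact congrFun h0 v)
  rw [sub_mulVec, smul_mulVec, one_mulVec] at h
  have : Module.End.HasEigenvalue (G.adjMatrix ℝ).mulVecLin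
      (G.adjSpectralRadius - hB.eigenvalues i) := by
    refine Module.End.hasEigenvalue_of_hasEigenvector (x := ⇑(hB.eigenvectorBasis i))
      ⟨Module.End.mem_eigenspace_iff.2 ?_, hne⟩
    rw [mulVecLin_apply, sub_smul, ← h, sub_sub_cancel]
  have := G.le_adjSpectralRadius this
  simp only [Pi.zero_apply]
  linarith

open Classical in
theorem hasEigenvalue_adjSpectralRadius [Nonempty V] (G : SimpleGraph V) :
    Module.End.HasEigenvalue (G.adjMatrix ℝ).mulVecLin G.adjSpectralRadius := by
  refine Set.Nonempty.csSup_mem ?_ (Module.End.finite_hasEigenvalue _)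
  have hA : (G.adjMatrix ℝ).IsHermitian := by
    rw [Matrix.IsHermitian, conjTranspose_eq_transpose_of_trivial]
    exact G.transpose_adjMatrix
  obtain ⟨i⟩ := ‹Nonempty V›
  refine ⟨hA.eigenvalues i, Module.End.hasEigenvalue_of_hasEigenvector
    (x := ⇑(hA.eigenvectorBasis i)) ⟨Module.End.mem_eigenspace_iff.2 ?_, ?_⟩⟩
  · exact hA.mulVec_eigenvectorBasis i
  · intro h0
    exact hA.eigenvectorBasis.orthonormal.ne_zero i (by ext v; exact congrFun h0 v)

open Classical in
theorem exists_eigenvector_adjSpectralRadius [Nonempty V] (G : SimpleGraph V) :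
    ∃ x : V → ℝ, x ≠ 0 ∧
      ∀ v, ∑ u, (if G.Adj v u then x u else 0) = G.adjSpectralRadius * x v := by
  obtain ⟨x, hx⟩ := G.hasEigenvalue_adjSpectralRadius.exists_hasEigenvector
  refine ⟨x, hx.2, fun v => ?_⟩
  have := congrFun hx.apply_eq_smul v
  rw [mulVecLin_apply, adjMatrix_mulVec_apply, neighborFinset_eq_filter, Finset.sum_filter] at this
  exact this

open Classical in
theorem dotProduct_adjSpectralRadius_sub (G : SimpleGraph V) (x : V → ℝ) :
    star x ⬝ᵥ (G.adjSpectralRadius • (1 : Matrix V V ℝ) - G.adjMatrix ℝ) *ᵥ x =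
      G.adjSpectralRadius * ∑ v, x v ^ 2 - ∑ u, ∑ v, (if G.Adj u v then x u * x v else 0) := by
  rw [sub_mulVec, smul_mulVec, one_mulVec, dotProduct_sub, dotProduct_smul, star_trivial,
    dotProduct_mulVec_adjMatrix]
  simp only [dotProduct, smul_eq_mul, sq]

open Classical in
/-- The Rayleigh principle: the quadratic form of the adjacency matrix is at most `ρ(G) ‖x‖²`. -/
theorem sum_adj_le_adjSpectralRadius_mul (G : SimpleGraph V) (x : V → ℝ) :
    ∑ u, ∑ v, (if G.Adj u v then x u * x v else 0) ≤ G.adjSpectralRadius * ∑ v, x v ^ 2 := by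
  have := G.posSemidef_adjSpectralRadius_sub.dotProduct_mulVec_nonneg x
  rw [dotProduct_adjSpectralRadius_sub] at this
  linarith

open Classical in
/-- The equality case of the Rayleigh principle: a maximizer is an eigenvector. -/
theorem eigenvector_of_sum_adj_eq (G : SimpleGraph V) (x : V → ℝ)
    (h : ∑ u, ∑ v, (if G.Adj u v then x u * x v else 0) = G.adjSpectralRadius * ∑ v, x v ^ 2)
    (v : V) : ∑ u, (if G.Adj v u then x u else 0) = G.adjSpectralRadius * x v := by
  have h0 := (G.posSemidef_adjSpectralRadius_sub.dotProduct_mulVec_zero_iff x).1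
    (by rw [dotProduct_adjSpectralRadius_sub, h, sub_self])
  have := congrFun h0 v
  rw [sub_mulVec, smul_mulVec, one_mulVec, Pi.sub_apply, adjMatrix_mulVec_apply,
    neighborFinset_eq_filter, Finset.sum_filter, Pi.smul_apply, smul_eq_mul, Pi.zero_apply] at this
  linarith

open Classical in
/-- The weak form of Perron's theorem: a connected graph has a positive eigenvector for its
spectral radius. Passing from an eigenvector to its absolute value does not decrease the Rayleigh
quotient, and a zero entry of a nonnegative eigenvector spreads to all neighbours. -/
theorem Connected.exists_pos_eigenvector {G : SimpleGraph V} (hG : G.Connected) :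
    ∃ x : V → ℝ, (∀ v, 0 < x v) ∧
      ∑ u, ∑ v, (if G.Adj u v then x u * x v else 0) = G.adjSpectralRadius * ∑ v, x v ^ 2 := by
  have := hG.nonempty
  obtain ⟨x, hx0, hx⟩ := G.exists_eigenvector_adjSpectralRadius
  have hq : ∑ u, ∑ v, (if G.Adj u v then |x u| * |x v| else 0)
      = G.adjSpectralRadius * ∑ v, |x v| ^ 2 := by
    refine le_antisymm (G.sum_adj_le_adjSpectralRadius_mul fun v => |x v|) ?_
    have h1 : ∑ u, ∑ v, (if G.Adj u v then x u * x v else 0)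
        = G.adjSpectralRadius * ∑ v, x v ^ 2 := by
      rw [Finset.mul_sum]
      refine Finset.sum_congr rfl fun u _ => ?_
      rw [sq, mul_left_comm, ← hx u, Finset.mul_sum]
      exact Finset.sum_congr rfl fun v _ => by rw [mul_ite, mul_zero]
    simp only [sq_abs]
    rw [← h1]
    refine Finset.sum_le_sum fun u _ => Finset.sum_le_sum fun v _ => ?_
    split_ifs
    · rw [← abs_mul]; exact le_abs_self _
    · rfl
  have hev := G.eigenvector_of_sum_adj_eq (fun v => |x v|) hq
  have hstep : ∀ u v, G.Adj u v → x u = 0 → x v = 0 := by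
    intro u v huv hu
    have h := hev u
    rw [hu, abs_zero, mul_zero, Finset.sum_eq_zero_iff_of_nonneg
      (fun w _ => by split_ifs <;> simp)] at h
    simpa [huv] using h v (Finset.mem_univ v)
  refine ⟨fun v => |x v|, fun v => abs_pos.2 fun hv => hx0 ?_, hq⟩
  ext w
  obtain ⟨p⟩ := hG.preconnected v w
  induction p with
  | nil => exact hv
  | cons h _ ih => exact ih (hstep _ _ h hv)

open Classical in
/-- Adding edges to a connected graph strictly increases the spectral radius. The larger graph may
live on another vertex type, identified with the first one by `e`. -/
theorem Connected.adjSpectralRadius_lt {G : SimpleGraph V} (hG : G.Connected) {H : SimpleGraph W}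
    (e : V ≃ W) (hle : ∀ u v, G.Adj u v → H.Adj (e u) (e v)) {a b : V}
    (hab : H.Adj (e a) (e b)) (hnab : ¬ G.Adj a b) :
    G.adjSpectralRadius < H.adjSpectralRadius := by
  obtain ⟨x, hx, hq⟩ := hG.exists_pos_eigenvector
  have hpos : 0 < ∑ v, x v ^ 2 :=
    Finset.sum_pos (fun v _ => pow_pos (hx v) 2) ⟨a, Finset.mem_univ a⟩
  have h1 := H.sum_adj_le_adjSpectralRadius_mul (fun w => x (e.symm w))
  simp only [← e.sum_comp, Equiv.symm_apply_apply] at h1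
  have h2 : ∑ u, ∑ v, (if G.Adj u v then x u * x v else 0)
      < ∑ u, ∑ v, (if H.Adj (e u) (e v) then x u * x v else 0) := by
    have key : ∀ u v, (if G.Adj u v then x u * x v else 0)
        ≤ (if H.Adj (e u) (e v) then x u * x v else 0) := by
      intro u v
      have := (mul_pos (hx u) (hx v)).le
      by_cases h : G.Adj u v
      · simp [h, hle u v h]
      · rw [if_neg h]; split_ifs <;> simp [this]
    refine Finset.sum_lt_sum (fun u _ => Finset.sum_le_sum fun v _ => key u v)
      ⟨a, Finset.mem_univ a, Finset.sum_lt_sum (fun v _ => key a v) ⟨b, Finset.mem_univ b, ?_⟩⟩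
    rw [if_neg hnab, if_pos hab]
    exact mul_pos (hx a) (hx b)
  rw [hq] at h2
  exact lt_of_mul_lt_mul_right (h2.trans_le h1) hpos.le

open Classical in
/-- **Hong's bound** `ρ(G)² ≤ 2m - n + 1` for a graph without isolated vertices. By Cauchy–Schwarz
`ρ² x_v² ≤ d(v) ∑_{u ∼ v} x_u²`; summing over `v`, the weight of `x_u²` is the sum of the degrees
of the neighbours of `u`, which is at most `2m - d(u) - (n - 1 - d(u))`. -/
theorem sq_adjSpectralRadius_le [Nonempty V] (G : SimpleGraph V) (hd : ∀ v, 1 ≤ G.degree v) :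
    G.adjSpectralRadius ^ 2 ≤ ∑ v, (G.degree v : ℝ) - Fintype.card V + 1 := by
  obtain ⟨x, hx0, hx⟩ := G.exists_eigenvector_adjSpectralRadius
  have hpos : 0 < ∑ v, x v ^ 2 := by
    obtain ⟨v, hv⟩ := Function.ne_iff.1 hx0
    exact Finset.sum_pos' (fun v _ => sq_nonneg _) ⟨v, Finset.mem_univ v, sq_pos_of_ne_zero hv⟩
  have hcs : ∀ v, G.adjSpectralRadius ^ 2 * x v ^ 2
      ≤ ∑ u, (if G.Adj u v then (G.degree v : ℝ) * x u ^ 2 else 0) := by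
    intro v
    have h := sq_sum_le_card_mul_sum_sq (s := G.neighborFinset v) (f := x)
    have h' := hx v
    rw [← Finset.sum_filter, ← neighborFinset_eq_filter] at h'
    rw [h', card_neighborFinset_eq_degree, mul_pow, neighborFinset_eq_filter, Finset.sum_filter,
      Finset.mul_sum] at h
    refine h.trans_eq (Finset.sum_congr rfl fun u _ => ?_)
    rw [mul_ite, mul_zero]
    simp only [G.adj_comm]
  have hw : ∀ u, ∑ v, (if G.Adj u v then (G.degree v : ℝ) else 0)
      ≤ ∑ v, (G.degree v : ℝ) - Fintype.card V + 1 := by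
    intro u
    have h1 : ∑ v, (if G.Adj u v then (1 : ℝ) else 0) = G.degree u := by
      rw [← Finset.sum_filter, ← neighborFinset_eq_filter, Finset.sum_const,
        card_neighborFinset_eq_degree, nsmul_one]
    have h2 : ∑ v, (if v = u then (G.degree u : ℝ) - 1 else 0) = G.degree u - 1 := by simp
    have h3 : ∑ _v : V, (1 : ℝ) = Fintype.card V := by simp
    have h4 : ∑ v, ((if G.Adj u v then (G.degree v : ℝ) else 0)
          + (if v = u then (G.degree u : ℝ) - 1 else 0) + 1)
        ≤ ∑ v, ((G.degree v : ℝ) + (if G.Adj u v then (1 : ℝ) else 0)) := by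
      refine Finset.sum_le_sum fun v _ => ?_
      have hdv : (1 : ℝ) ≤ G.degree v := by exact_mod_cast hd v
      by_cases hvu : v = u
      · subst hvu; simp
      · by_cases h : G.Adj u v <;> simp [h, hvu, hdv]
    rw [Finset.sum_add_distrib, Finset.sum_add_distrib, Finset.sum_add_distrib, h1, h2, h3] at h4
    linarith
  refine le_of_mul_le_mul_right ?_ hpos
  calc G.adjSpectralRadius ^ 2 * ∑ v, x v ^ 2
      ≤ ∑ v, ∑ u, (if G.Adj u v then (G.degree v : ℝ) * x u ^ 2 else 0) := by
        rw [Finset.mul_sum]; exact Finset.sum_le_sum fun v _ => hcs v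
    _ = ∑ u, (∑ v, (if G.Adj u v then (G.degree v : ℝ) else 0)) * x u ^ 2 := by
        rw [Finset.sum_comm]
        refine Finset.sum_congr rfl fun u _ => ?_
        rw [Finset.sum_mul]
        exact Finset.sum_congr rfl fun v _ => by rw [ite_mul, zero_mul]
    _ ≤ _ := by
        rw [Finset.mul_sum]
        exact Finset.sum_le_sum fun u _ => mul_le_mul_of_nonneg_right (hw u) (sq_nonneg _)

end Spectral

/-! ### Barriers and edge counting -/

section Structure

variable {V : Type*} [Fintype V]

/-- A Tutte violator of `G - S₀` with `|S₀| = k`, together with `S₀`. Parity improves the excess of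
odd components by one, so that there are at least `|S| - k + 2` components; they are encoded by a
labelling `f` with exactly that many classes. Only the labels of vertices outside `S` matter. -/
theorem exists_barrier {G : SimpleGraph V} {k t : ℕ}
    (hparity : Fintype.card V ≡ k [MOD 2]) (hconn : G.IsTConnected t)
    (h : ¬ G.IsKFactorCritical k) :
    ∃ S : Finset V, t ≤ S.card ∧ ∃ f : V → Fin (S.card - k + 2),
      (∀ i, ∃ v, v ∉ S ∧ f v = i) ∧ ∀ u v, u ∉ S → v ∉ S → G.Adj u v → f u = f v := by
  classical
  simp only [IsKFactorCritical, not_forall] at h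
  obtain ⟨S₀, hS₀, hM⟩ := h
  rw [tutte] at hM
  push Not at hM
  obtain ⟨u, hu⟩ := hM
  rw [IsTutteViolator] at hu
  set H := G.induce ((S₀ : Set V)ᶜ) with hH
  set H' := ((⊤ : H.Subgraph).deleteVerts u) with hH'
  have hcardH : Nat.card ↥((S₀ : Set V)ᶜ) + k = Fintype.card V := by
    rw [Nat.card_coe_set_eq, ← hS₀, ← Set.ncard_coe_finset S₀, add_comm,
      Set.ncard_add_ncard_compl, Nat.card_eq_fintype_card]
  have hcardH' : Nat.card H'.verts + u.ncard = Nat.card ↥((S₀ : Set V)ᶜ) := by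
    have : H'.verts = uᶜ := by ext; simp [hH']
    rw [this, Nat.card_coe_set_eq, add_comm, Set.ncard_add_ncard_compl]
  have hodd := odd_ncard_oddComponents H'.coe
  have htwo : u.ncard + 2 ≤ H'.coe.oddComponents.ncard := by
    rw [Nat.odd_iff, Nat.odd_iff] at hodd
    unfold Nat.ModEq at hparity
    omega
  have hcomp : u.ncard + 2 ≤ Nat.card H'.coe.ConnectedComponent :=
    htwo.trans (Set.ncard_le_card _)
  set S : Finset V := S₀ ∪ u.toFinset.map (Function.Embedding.subtype _) with hS
  have hScard : S.card = k + u.ncard := by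
    rw [hS, Finset.card_union_of_disjoint, Finset.card_map, hS₀, Set.ncard_eq_toFinset_card']
    rw [Finset.disjoint_left]
    intro a ha hb
    simp only [Finset.mem_map, Set.mem_toFinset] at hb
    obtain ⟨⟨b, hb'⟩, -, rfl⟩ := hb
    exact hb' ha
  have hmem : ∀ v, v ∉ S → ∃ h : v ∈ ((S₀ : Set V)ᶜ), (⟨v, h⟩ : ↥((S₀ : Set V)ᶜ)) ∈ H'.verts := by
    intro v hv
    simp only [hS, Finset.mem_union, not_or, Finset.mem_map, Set.mem_toFinset, not_exists,
      not_and] at hv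
    refine ⟨hv.1, ?_⟩
    simp only [hH', Subgraph.deleteVerts_verts, Subgraph.verts_top, Set.mem_sdiff, Set.mem_univ,
      true_and]
    exact fun h => hv.2 _ h rfl
  have hmem' : ∀ w : H'.verts, w.1.1 ∉ S := by
    rintro ⟨⟨v, hv⟩, hw⟩ hvS
    simp only [hH', Subgraph.deleteVerts_verts, Subgraph.verts_top, Set.mem_sdiff, Set.mem_univ,
      true_and] at hw
    simp only [hS, Finset.mem_union, Finset.mem_map, Set.mem_toFinset] at hvS
    obtain h | ⟨⟨b, hb⟩, hbu, rfl⟩ := hvS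
    · exact hv h
    · exact hw hbu
  -- the components are merged into exactly `|S| - k + 2` classes
  obtain ⟨g, hg⟩ : ∃ g : H'.coe.ConnectedComponent → Fin (S.card - k + 2),
      Function.Surjective g := by
    have : Finite H'.coe.ConnectedComponent := inferInstance
    have := Fintype.ofFinite H'.coe.ConnectedComponent
    obtain ⟨e⟩ := Function.Embedding.nonempty_of_card_le (α := Fin (S.card - k + 2))
      (β := H'.coe.ConnectedComponent) (by
        rw [Fintype.card_fin, ← Nat.card_eq_fintype_card]; omega)
    have : Nonempty (Fin (S.card - k + 2)) := ⟨0⟩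
    exact ⟨Function.invFun e, Function.invFun_surjective e.injective⟩
  let f : V → Fin (S.card - k + 2) := fun v =>
    if hv : v ∉ S then g (H'.coe.connectedComponentMk ⟨⟨v, (hmem v hv).1⟩, (hmem v hv).2⟩) else 0
  have hfsurj : ∀ i, ∃ v, v ∉ S ∧ f v = i := by
    intro i
    obtain ⟨C, rfl⟩ := hg i
    obtain ⟨w, rfl⟩ := C.exists_rep
    exact ⟨w.1.1, hmem' w, by simp only [f, dif_pos (hmem' w)]; rfl⟩
  have hfadj : ∀ u v, u ∉ S → v ∉ S → G.Adj u v → f u = f v := by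
    intro a b ha hb hab
    simp only [f, dif_pos ha, dif_pos hb]
    congr 1
    refine ConnectedComponent.connectedComponentMk_eq_of_adj ?_
    have h1 := (hmem a ha).2
    have h2 := (hmem b hb).2
    simp only [hH', Subgraph.deleteVerts_verts, Subgraph.verts_top, Set.mem_sdiff, Set.mem_univ,
      true_and] at h1 h2
    simp [hH', hH, hab, h1, h2]
  refine ⟨S, ?_, f, hfsurj, hfadj⟩
  by_contra! hlt
  have hpre := (hconn.2.2 S hlt).preconnected
  have hnot : ∀ a : ↥((S : Set V)ᶜ), (a : V) ∉ S := fun a ha =>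
    a.2 (Finset.mem_coe.2 ha)
  have hconst : ∀ a b : ↥((S : Set V)ᶜ), f a = f b := by
    intro a b
    obtain ⟨p⟩ := hpre a b
    induction p with
    | nil => rfl
    | cons h _ ih => exact (hfadj _ _ (hnot _) (hnot _) h).trans ih
  obtain ⟨a, ha, ha0⟩ := hfsurj 0
  obtain ⟨b, hb, hb1⟩ := hfsurj 1
  have := hconst ⟨a, by simpa using ha⟩ ⟨b, by simpa using hb⟩
  rw [ha0, hb1] at this
  simp at this

open Classical in
/-- The number of vertices outside `S` with label `i`. -/
noncomputable def partSize (S : Finset V) {c : ℕ} (f : V → Fin c) (i : Fin c) : ℕ :=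
  (Finset.univ.filter fun v => v ∉ S ∧ f v = i).card

theorem sum_partSize (S : Finset V) {c : ℕ} (f : V → Fin c) :
    ∑ i, partSize S f i + S.card = Fintype.card V := by
  classical
  have h := Finset.card_eq_sum_card_fiberwise (f := f) (s := Sᶜ) (t := Finset.univ)
    (fun _ _ => Finset.mem_univ _)
  rw [← Finset.card_add_card_compl S, h, add_comm]
  congr 1
  refine Finset.sum_congr rfl fun i _ => ?_
  rw [partSize]
  congr 1
  ext v; simp

open Classical in
/-- Each vertex of `S` has degree at most `n - 1`, and any other vertex is adjacent only to `S`
and to its own class. -/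
theorem sum_degree_add_card_le (G : SimpleGraph V) (S : Finset V) {c : ℕ} (f : V → Fin c)
    (hf : ∀ u v, u ∉ S → v ∉ S → G.Adj u v → f u = f v) :
    ∑ v, (G.degree v : ℝ) + Fintype.card V ≤ S.card * Fintype.card V
      + (Fintype.card V - S.card) * S.card + ∑ i, (partSize S f i : ℝ) ^ 2 := by
  have h1 : ∀ v ∈ S, ((G.degree v : ℝ) + 1) ≤ Fintype.card V := fun v _ => by
    exact_mod_cast G.degree_lt_card_verts v
  have h2 : ∀ v ∈ Sᶜ, ((G.degree v : ℝ) + 1) ≤ S.card + partSize S f (f v) := fun v hv => by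
    rw [Finset.mem_compl] at hv
    have hsub : insert v (G.neighborFinset v)
        ⊆ S ∪ Finset.univ.filter fun w => w ∉ S ∧ f w = f v := by
      intro w hw
      rw [Finset.mem_insert, mem_neighborFinset] at hw
      rw [Finset.mem_union, Finset.mem_filter]
      by_cases hwS : w ∈ S
      · exact Or.inl hwS
      · refine Or.inr ⟨Finset.mem_univ _, hwS, ?_⟩
        obtain rfl | hw := hw
        · rfl
        · exact (hf v w hv hwS hw).symm
    have := (Finset.card_le_card hsub).trans (Finset.card_union_le _ _)
    rw [Finset.card_insert_of_notMem (by simp), card_neighborFinset_eq_degree] at this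
    exact_mod_cast this
  have h3 : ∑ v ∈ Sᶜ, (partSize S f (f v) : ℝ) = ∑ i, (partSize S f i : ℝ) ^ 2 := by
    rw [← Finset.sum_fiberwise Sᶜ f]
    refine Finset.sum_congr rfl fun i _ => ?_
    rw [Finset.sum_congr rfl (g := fun _ => (partSize S f i : ℝ))
      (fun v hv => by rw [(Finset.mem_filter.1 hv).2]), Finset.sum_const, nsmul_eq_mul, sq]
    congr 2
    rw [partSize]
    congr 1
    ext v; simp
  have hc : ((Sᶜ.card : ℕ) : ℝ) = Fintype.card V - S.card := by
    rw [Finset.card_compl, Nat.cast_sub (Finset.card_le_univ S)]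
  calc ∑ v, (G.degree v : ℝ) + Fintype.card V = ∑ v, ((G.degree v : ℝ) + 1) := by
        rw [Finset.sum_add_distrib]; simp
    _ = ∑ v ∈ S, ((G.degree v : ℝ) + 1) + ∑ v ∈ Sᶜ, ((G.degree v : ℝ) + 1) :=
        (Finset.sum_add_sum_compl S _).symm
    _ ≤ ∑ _v ∈ S, (Fintype.card V : ℝ) + ∑ v ∈ Sᶜ, ((S.card : ℝ) + partSize S f (f v)) :=
        add_le_add (Finset.sum_le_sum h1) (Finset.sum_le_sum h2)
    _ = _ := by
        rw [Finset.sum_add_distrib, h3, Finset.sum_const, Finset.sum_const, nsmul_eq_mul,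
          nsmul_eq_mul, hc, add_assoc]

theorem sum_sq_le_sq_sum_of_nonneg {ι : Type*} (s : Finset ι) (p : ι → ℝ)
    (hp : ∀ i ∈ s, 0 ≤ p i) : ∑ i ∈ s, p i ^ 2 ≤ (∑ i ∈ s, p i) ^ 2 := by
  rw [sq (∑ i ∈ s, p i), Finset.sum_mul]
  refine Finset.sum_le_sum fun i hi => ?_
  rw [sq]
  exact mul_le_mul_of_nonneg_left (Finset.single_le_sum hp hi) (hp i hi)

/-- A sum of squares with given total, two of whose terms are at least one, is largest when the rest
of the total is concentrated on one of these terms. -/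
theorem sum_sq_le_of_two_nontrivial {ι : Type*} [Fintype ι] (p : ι → ℝ) (hp : ∀ i, 0 ≤ p i)
    {i j : ι} (hij : i ≠ j) (hi : 1 ≤ p i) (hj : 1 ≤ p j) :
    ∑ l, p l ^ 2 ≤ (∑ l, p l - 1) ^ 2 + 1 := by
  classical
  rw [← Finset.add_sum_erase _ _ (Finset.mem_univ i),
    ← Finset.add_sum_erase _ p (Finset.mem_univ i)]
  have h1 := sum_sq_le_sq_sum_of_nonneg (Finset.univ.erase i) p fun l _ => hp l
  have h2 : 1 ≤ ∑ l ∈ Finset.univ.erase i, p l :=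
    hj.trans (Finset.single_le_sum (fun l _ => hp l)
      (Finset.mem_erase.2 ⟨hij.symm, Finset.mem_univ _⟩))
  nlinarith [mul_nonneg (sub_nonneg.2 hi) (sub_nonneg.2 h2)]

end Structure

/-! ### The extremal graph -/

section Extremal

variable {n k t : ℕ}

@[simp]
theorem extremalGraph_adj_inl_inl (i j : Fin t) :
    (extremalGraph n k t).Adj (Sum.inl i) (Sum.inl j) ↔ i ≠ j := by
  simp [extremalGraph, joinGraph]

@[simp]
theorem extremalGraph_adj_inl_inr (i : Fin t) (x : Fin (n + k - 2 * t - 1) ⊕ Fin (t - k + 1)) :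
    (extremalGraph n k t).Adj (Sum.inl i) (Sum.inr x) := by
  simp [extremalGraph, joinGraph]

@[simp]
theorem extremalGraph_adj_inr_inl (i : Fin t) (x : Fin (n + k - 2 * t - 1) ⊕ Fin (t - k + 1)) :
    (extremalGraph n k t).Adj (Sum.inr x) (Sum.inl i) := by
  simp [extremalGraph, joinGraph]

@[simp]
theorem extremalGraph_adj_clique (i j : Fin (n + k - 2 * t - 1)) :
    (extremalGraph n k t).Adj (Sum.inr (Sum.inl i)) (Sum.inr (Sum.inl j)) ↔ i ≠ j := by
  simp [extremalGraph, joinGraph]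

@[simp]
theorem extremalGraph_not_adj_clique_indep (i : Fin (n + k - 2 * t - 1)) (j : Fin (t - k + 1)) :
    ¬ (extremalGraph n k t).Adj (Sum.inr (Sum.inl i)) (Sum.inr (Sum.inr j)) := by
  simp [extremalGraph, joinGraph]

@[simp]
theorem extremalGraph_not_adj_indep_clique (i : Fin (n + k - 2 * t - 1)) (j : Fin (t - k + 1)) :
    ¬ (extremalGraph n k t).Adj (Sum.inr (Sum.inr j)) (Sum.inr (Sum.inl i)) := by
  simp [extremalGraph, joinGraph]

@[simp]
theorem extremalGraph_not_adj_indep (i j : Fin (t - k + 1)) :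
    ¬ (extremalGraph n k t).Adj (Sum.inr (Sum.inr i)) (Sum.inr (Sum.inr j)) := by
  simp [extremalGraph, joinGraph]

/-- The extremal graph contains a clique on `n + k - t - 1` vertices properly, and so its spectral
radius exceeds that of the clique. -/
theorem lt_adjSpectralRadius_extremalGraph (ht : 1 ≤ t) (hn : 2 * t + 1 ≤ n + k)
    (hpos : t + 2 < n + k) :
    (n : ℝ) + k - t - 2 < (extremalGraph n k t).adjSpectralRadius := by
  classical
  -- the test vector is `1` on the clique and a small positive constant elsewhere
  set N : ℝ := (n : ℝ) + k - t - 2 with hN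
  have hN0 : 0 < N := by
    have : (t : ℝ) + 2 < n + k := by exact_mod_cast hpos
    rw [hN]; linarith
  set m : ℝ := ((n + k - 2 * t - 1 : ℕ) : ℝ) with hm
  have hm' : m = N + 1 - t := by
    rw [hm, Nat.sub_sub, Nat.cast_sub hn, hN]; push_cast; ring
  set r : ℝ := ((t - k + 1 : ℕ) : ℝ) with hr
  have hr0 : 0 < r := by rw [hr]; positivity
  have ht0 : (1 : ℝ) ≤ t := by exact_mod_cast ht
  have hne : ∀ q : ℕ, ∑ i : Fin q, ∑ j : Fin q, (if i ≠ j then (1 : ℝ) else 0) = q * (q - 1) := by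
    intro q
    have : ∀ i : Fin q, ∑ j : Fin q, (if i ≠ j then (1 : ℝ) else 0) = q - 1 := by
      intro i
      rw [Finset.sum_congr rfl (g := fun j => 1 - if i = j then (1 : ℝ) else 0)
        (fun j _ => by split_ifs <;> simp_all), Finset.sum_sub_distrib]
      simp
    simp only [this, Finset.sum_const, Finset.card_univ, Fintype.card_fin, nsmul_eq_mul]
  have h := (extremalGraph n k t).sum_adj_le_adjSpectralRadius_mul
    (Sum.elim (fun _ => 1) (Sum.elim (fun _ => 1) fun _ => N⁻¹))
  simp only [Fintype.sum_sum_type, Sum.elim_inl, Sum.elim_inr, extremalGraph_adj_inl_inl,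
    extremalGraph_adj_inl_inr, extremalGraph_adj_inr_inl, extremalGraph_adj_clique,
    extremalGraph_not_adj_clique_indep, extremalGraph_not_adj_indep_clique,
    extremalGraph_not_adj_indep, if_true, if_false, mul_one, one_mul, Finset.sum_add_distrib,
    hne, Finset.sum_const, Finset.card_univ, Fintype.card_fin, nsmul_eq_mul, one_pow,
    mul_zero, add_zero] at h
  rw [← hm, ← hr, hm'] at h
  refine lt_of_mul_lt_mul_right (lt_of_lt_of_le ?_ h)
    (show 0 ≤ (t : ℝ) + (N + 1 - t + r * N⁻¹ ^ 2) by
      rw [← hm', hm]; positivity)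
  have hNN : N * N⁻¹ = 1 := mul_inv_cancel₀ hN0.ne'
  have h1 : 0 < N⁻¹ := inv_pos.2 hN0
  have h2 : N * (r * N⁻¹ ^ 2) = r * N⁻¹ := by rw [sq]; linear_combination r * N⁻¹ * hNN
  have h3 : 0 < r * N⁻¹ := mul_pos hr0 h1
  nlinarith

/-- Deleting `k` of the dominating vertices leaves `t - k + 1` isolated vertices whose only
neighbours are the remaining `t - k` dominating ones. -/
theorem not_isKFactorCritical_of_iso {V : Type*} {G : SimpleGraph V}
    (e : G ≃g extremalGraph n k t) (hkt : k ≤ t) : ¬ G.IsKFactorCritical k := by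
  classical
  intro h
  obtain ⟨T, hT⟩ := Finset.exists_subset_card_eq (s := (Finset.univ : Finset (Fin t))) (n := k)
    (by simpa using hkt)
  set S : Finset V := T.image (fun i => e.symm (Sum.inl i)) with hS
  obtain ⟨M, hM⟩ := h S (by
    rw [hS, Finset.card_image_of_injective _ (fun a b hab => by simpa using hab), hT.2])
  have hmem : ∀ j, e.symm (Sum.inr (Sum.inr j)) ∈ ((S : Set V)ᶜ) := by
    intro j
    simp [hS]
  have key : ∀ j : Fin (t - k + 1), ∃ i : Fin t, i ∈ Tᶜ ∧
      ∃ hi : e.symm (Sum.inl i) ∈ ((S : Set V)ᶜ),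
      M.Adj ⟨_, hmem j⟩ ⟨_, hi⟩ := by
    intro j
    obtain ⟨⟨w, hw⟩, hadj, -⟩ := Subgraph.isPerfectMatching_iff.1 hM ⟨_, hmem j⟩
    have hG : G.Adj (e.symm (Sum.inr (Sum.inr j))) w := M.adj_sub hadj
    obtain ⟨x, rfl⟩ := e.symm.surjective w
    rw [e.symm.map_adj_iff] at hG
    match x, hG with
    | Sum.inl i, _ =>
      refine ⟨i, ?_, hw, hadj⟩
      rw [Finset.mem_compl]
      intro hi
      exact hw (by simpa [hS] using hi)
    | Sum.inr (Sum.inl i), hG => exact absurd hG (by simp)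
    | Sum.inr (Sum.inr i), hG => exact absurd hG (by simp)
  choose g hg hg' hadj using key
  have hinj : Function.Injective g := by
    intro a b hab
    have h1 := hadj a
    have h2 := hadj b
    obtain ⟨w, -, hu⟩ := Subgraph.isPerfectMatching_iff.1 hM ⟨_, hg' a⟩
    have h3 := hu _ h1.symm
    have h4 := hu ⟨_, hmem b⟩ (by simp only [hab]; exact h2.symm)
    have := congrArg Subtype.val (h3.trans h4.symm)
    simpa using this
  have := Finset.card_le_card_of_injOn (s := Finset.univ) (t := Tᶜ) g (fun j _ => hg j) hinj.injOn
  rw [Finset.card_univ, Fintype.card_fin, Finset.card_compl, Fintype.card_fin, hT.2] at this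
  omega

/-- If all classes but one outside `S` are singletons, the graph is a subgraph of the extremal
graph. -/
theorem exists_equiv_extremalGraph {V : Type*} [Fintype V] {G : SimpleGraph V}
    (hcard : Fintype.card V = n) {S : Finset V} (hS : S.card = t) {c : ℕ} (hc : c = t - k + 2)
    (hkt : k ≤ t) (f : V → Fin c)
    (hf : ∀ u v, u ∉ S → v ∉ S → G.Adj u v → f u = f v) (i₀ : Fin c)
    (hi₀ : ∀ i, i ≠ i₀ → partSize S f i = 1) :
    ∃ e : (Fin t ⊕ (Fin (n + k - 2 * t - 1) ⊕ Fin (t - k + 1))) ≃ V,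
      ∀ a b, G.Adj (e a) (e b) → (extremalGraph n k t).Adj a b := by
  classical
  have hsum := sum_partSize S f
  rw [← Finset.add_sum_erase _ _ (Finset.mem_univ i₀),
    Finset.sum_congr rfl (fun i hi => hi₀ i (Finset.ne_of_mem_erase hi)), Finset.sum_const,
    Finset.card_erase_of_mem (Finset.mem_univ _), Finset.card_univ, Fintype.card_fin, smul_eq_mul,
    mul_one, hcard, hS] at hsum
  have hA : Fintype.card {v // v ∈ S} = t := by rw [Fintype.card_coe, hS]
  have hB : Fintype.card {w : {v // v ∉ S} // f w.1 = i₀} = n + k - 2 * t - 1 := by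
    have : Fintype.card {w : {v // v ∉ S} // f w.1 = i₀} = partSize S f i₀ := by
      rw [Fintype.card_congr (Equiv.subtypeSubtypeEquivSubtypeInter (· ∉ S) fun v => f v = i₀),
        Fintype.card_subtype, partSize]
    omega
  have hC : Fintype.card {w : {v // v ∉ S} // ¬ f w.1 = i₀} = t - k + 1 := by
    have h1 := Fintype.card_subtype_compl (fun w : {v // v ∉ S} => f w.1 = i₀)
    have h2 : Fintype.card {v // v ∉ S} = n - t := by
      rw [Fintype.card_subtype_compl, hA, hcard]
    omega
  let e : (Fin t ⊕ (Fin (n + k - 2 * t - 1) ⊕ Fin (t - k + 1))) ≃ V :=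
    (Equiv.sumCongr (Fintype.equivFinOfCardEq hA).symm
      ((Equiv.sumCongr (Fintype.equivFinOfCardEq hB).symm (Fintype.equivFinOfCardEq hC).symm).trans
        (Equiv.sumCompl fun w : {v // v ∉ S} => f w.1 = i₀))).trans (Equiv.sumCompl (· ∈ S))
  have he1 : ∀ i, e (Sum.inr (Sum.inl i)) ∉ S ∧ f (e (Sum.inr (Sum.inl i))) = i₀ := fun i =>
    ⟨((Fintype.equivFinOfCardEq hB).symm i).1.2, ((Fintype.equivFinOfCardEq hB).symm i).2⟩
  have he2 : ∀ i, e (Sum.inr (Sum.inr i)) ∉ S ∧ f (e (Sum.inr (Sum.inr i))) ≠ i₀ := fun i =>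
    ⟨((Fintype.equivFinOfCardEq hC).symm i).1.2, ((Fintype.equivFinOfCardEq hC).symm i).2⟩
  refine ⟨e, ?_⟩
  rintro (a | a | a) (b | b | b) hab
  · rw [extremalGraph_adj_inl_inl]; rintro rfl; exact G.irrefl hab
  · simp
  · simp
  · simp
  · rw [extremalGraph_adj_clique]; rintro rfl; exact G.irrefl hab
  · exact absurd ((hf _ _ (he1 a).1 (he2 b).1 hab).symm.trans (he1 a).2) (he2 b).2
  · simp
  · exact absurd ((hf _ _ (he2 a).1 (he1 b).1 hab).trans (he1 b).2) (he2 a).2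
  · exfalso
    have heq := hf _ _ (he2 a).1 (he2 b).1 hab
    have h1 := hi₀ _ (he2 a).2
    rw [partSize] at h1
    have := Finset.card_le_one.1 h1.le (e (Sum.inr (Sum.inr a)))
      (Finset.mem_filter.2 ⟨Finset.mem_univ _, (he2 a).1, rfl⟩) (e (Sum.inr (Sum.inr b)))
      (Finset.mem_filter.2 ⟨Finset.mem_univ _, (he2 b).1, heq.symm⟩)
    exact G.ne_of_adj hab this

end Extremal

/-! ### Comparison of the edge bounds with the spectral radius -/

/-- For `s ≥ t + 1` the edge bound for a barrier of size `s`, inserted into Hong's bound, is at most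
`(n + k - t - 2)²`. The hypothesis `2 * s ≤ n + k - 2` says that the classes are nonempty. -/
theorem barrier_bound_large {n k t s : ℝ} (hk : 1 ≤ k) (hkt : k ≤ t)
    (h1 : (15 * t - 11 * k + 29) / 2 ≤ n) (h2 : t ^ 2 + 5 / 2 * t + 2 ≤ n)
    (hs : t + 1 ≤ s) (hsn : 2 * s ≤ n + k - 2) :
    s * n + (n - s) * s + ((n - 2 * s + k - 2) ^ 2 + 2 * (n - 2 * s + k - 2) + (s - k + 2))
      - n - n + 1 ≤ (n + k - t - 2) ^ 2 := by
  -- the bound needed at the right end `2 * s = n + k - 2`; as `17 / 2 ≥ (t - k) / 2` for `t ≤ 17`,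
  -- the linear bound on `n` suffices there, and the quadratic one for larger `t`
  have hlin : 8 * t - 6 * k + 6 ≤ n := by
    by_cases ht : t ≤ 17
    · linarith
    · nlinarith
  -- the left side is convex in `s`, so it is bounded by its value at one of the two ends
  obtain h | h := le_total (3 * (s + (t + 1)) + (5 - 2 * n - 4 * k)) 0
  · have h3 := mul_nonneg (sub_nonneg.2 hs) (sub_nonneg.2 h)
    nlinarith [mul_nonneg (sub_nonneg.2 hk) (sub_nonneg.2 hkt)]
  · have h3 := mul_nonneg (sub_nonneg.2 hsn)
      (show 0 ≤ 3 * (s + (n + k - 2) / 2) + (5 - 2 * n - 4 * k) by linarith)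
    have h4 : 0 ≤ n := by nlinarith
    nlinarith [mul_nonneg h4 (sub_nonneg.2 hlin), sq_nonneg (k - 1), sq_nonneg (t - k),
      sub_nonneg.2 hkt]

/-- The analogue of `barrier_bound_large` for `s = t`, when two classes have at least two vertices
each. -/
theorem barrier_bound_small {n k t : ℝ} (hk : 1 ≤ k) (hkt : k ≤ t)
    (h2 : t ^ 2 + 5 / 2 * t + 2 ≤ n) :
    t * n + (n - t) * t
      + (((n - 2 * t + k - 2) - 1) ^ 2 + 1 + 2 * (n - 2 * t + k - 2) + (t - k + 2))
      - n - n + 1 ≤ (n + k - t - 2) ^ 2 := by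
  nlinarith [mul_nonneg (sub_nonneg.2 hk) (sub_nonneg.2 hkt)]

end SimpleGraph

open SimpleGraph in
theorem theorem1p5 {V : Type*} [Fintype V] (G : SimpleGraph V) (n k t : ℕ)
    (hcard : Fintype.card V = n)
    (hn : max ((15 * (t : ℝ) - 11 * (k : ℝ) + 29) / 2) ((t : ℝ) ^ 2 + 5 / 2 * (t : ℝ) + 2)
      ≤ (n : ℝ))
    (hk : 1 ≤ k) (hkt : k ≤ t) (hparity : n ≡ k [MOD 2])
    (hconn : G.IsTConnected t)
    (hρ : (SimpleGraph.extremalGraph n k t).adjSpectralRadius ≤ G.adjSpectralRadius) :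
    G.IsKFactorCritical k ↔ ¬ Nonempty (G ≃g SimpleGraph.extremalGraph n k t) := by
  classical
  refine ⟨fun h ⟨e⟩ => not_isKFactorCritical_of_iso e hkt h, fun hiso => ?_⟩
  by_contra hcrit
  obtain ⟨S, htS, f, hsurj, hf⟩ := exists_barrier (hcard ▸ hparity) hconn hcrit
  obtain ⟨hn1, hn2⟩ := max_le_iff.1 hn
  have hkR : (1 : ℝ) ≤ k := by exact_mod_cast hk
  have hktR : (k : ℝ) ≤ t := by exact_mod_cast hkt
  have hlarge : 2 * t + 2 ≤ n := by
    have : (2 * t + 2 : ℝ) ≤ n := by nlinarith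
    exact_mod_cast this
  have := hconn.1.nonempty
  have : Nontrivial V := Fintype.one_lt_card_iff_nontrivial.1 (by omega)
  have hN0 : (0 : ℝ) ≤ n + k - t - 2 := by
    have : (2 * t + 2 : ℝ) ≤ n := by exact_mod_cast hlarge
    linarith
  have hext := lt_adjSpectralRadius_extremalGraph (n := n) (k := k) (t := t) (by omega) (by omega)
    (by omega)
  have hhong : ¬ (∑ v, (G.degree v : ℝ) - n + 1 ≤ ((n : ℝ) + k - t - 2) ^ 2) := by
    intro hle
    have h1 := G.sq_adjSpectralRadius_le fun v => hconn.1.preconnected.degree_pos_of_nontrivial v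
    rw [hcard] at h1
    exact absurd (hext.trans_le hρ) (not_lt.2
      (le_of_abs_le (abs_le_of_sq_le_sq (h1.trans hle) hN0)))
  have hdeg := sum_degree_add_card_le G S f hf
  rw [hcard] at hdeg
  have hpart : ∀ i, 1 ≤ partSize S f i := by
    intro i
    obtain ⟨v, hv, hvi⟩ := hsurj i
    exact Finset.card_pos.2 ⟨v, Finset.mem_filter.2 ⟨Finset.mem_univ v, hv, hvi⟩⟩
  -- excess of the class sizes over one, and their total
  set p : Fin (S.card - k + 2) → ℝ := fun i => partSize S f i - 1 with hp
  have hp0 : ∀ i, 0 ≤ p i := fun i => by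
    have : (1 : ℝ) ≤ partSize S f i := by exact_mod_cast hpart i
    simp only [hp]; linarith
  have hcR : ((S.card - k + 2 : ℕ) : ℝ) = S.card - k + 2 := by
    push_cast [Nat.cast_sub (hkt.trans htS)]; ring
  have hpsum : ∑ i, p i = n - 2 * S.card + k - 2 := by
    have h := sum_partSize S f
    rw [hcard] at h
    have h' : ∑ i, (partSize S f i : ℝ) + S.card = n := by exact_mod_cast h
    simp only [hp, Finset.sum_sub_distrib, Finset.sum_const, Finset.card_univ, Fintype.card_fin,
      nsmul_eq_mul, mul_one, hcR]
    linarith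
  have hsq : ∑ i, (partSize S f i : ℝ) ^ 2
      = ∑ i, p i ^ 2 + 2 * ∑ i, p i + (S.card - k + 2) := by
    rw [← hcR, Finset.mul_sum, ← Finset.sum_add_distrib]
    have : ((S.card - k + 2 : ℕ) : ℝ) = ∑ _i : Fin (S.card - k + 2), (1 : ℝ) := by simp
    rw [this, ← Finset.sum_add_distrib]
    exact Finset.sum_congr rfl fun i _ => by simp only [hp]; ring
  rw [hsq, hpsum] at hdeg
  obtain hlt | heq := htS.lt_or_eq
  · have hb := barrier_bound_large (s := S.card) hkR hktR hn1 hn2 (by exact_mod_cast hlt)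
      (by have := Finset.sum_nonneg fun i (_ : i ∈ Finset.univ) => hp0 i; linarith)
    have hps := sum_sq_le_sq_sum_of_nonneg Finset.univ p fun i _ => hp0 i
    rw [hpsum] at hps
    exact hhong (by linarith)
  by_cases htwo : ∃ i j, i ≠ j ∧ 2 ≤ partSize S f i ∧ 2 ≤ partSize S f j
  · obtain ⟨i, j, hij, hi, hj⟩ := htwo
    have hi' : (2 : ℝ) ≤ partSize S f i := by exact_mod_cast hi
    have hj' : (2 : ℝ) ≤ partSize S f j := by exact_mod_cast hj
    have hps := sum_sq_le_of_two_nontrivial p hp0 hij (by simp only [hp]; linarith)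
      (by simp only [hp]; linarith)
    rw [hpsum] at hps
    have hb := barrier_bound_small hkR hktR hn2
    have heqR : (t : ℝ) = S.card := by exact_mod_cast heq
    rw [heqR] at hb hhong
    exact hhong (by linarith)
  obtain ⟨i₀, hi₀⟩ : ∃ i₀, ∀ i, i ≠ i₀ → partSize S f i = 1 := by
    by_cases h : ∃ i, 2 ≤ partSize S f i
    · obtain ⟨i, hi⟩ := h
      refine ⟨i, fun j hj => ?_⟩
      by_contra hne
      exact htwo ⟨i, j, hj.symm, hi, by have := hpart j; omega⟩
    · push Not at h
      exact ⟨0, fun i _ => by have := h i; have := hpart i; omega⟩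
  obtain ⟨e, he⟩ := exists_equiv_extremalGraph hcard heq.symm (by rw [← heq]) hkt f hf i₀ hi₀
  by_cases hall : ∀ a b, (extremalGraph n k t).Adj a b → G.Adj (e a) (e b)
  · exact hiso ⟨(RelIso.mk e fun {a b} => ⟨he a b, hall a b⟩ : extremalGraph n k t ≃g G).symm⟩
  · push Not at hall
    obtain ⟨a, b, hab, hnab⟩ := hall
    exact absurd hρ (not_le.2 (hconn.1.adjSpectralRadius_lt e.symm
      (fun u v huv => he _ _ (by simpa using huv)) (a := e a) (b := e b) (by simpa using hab) hnab))
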